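/- All graphs are finite, simple and undirected. A total-colouring of a graph assigns a colour to every vertex and to every edge (vertices and edges share one set of colours, and no condition is imposed on the assignment). A path in a total-coloured graph is a *total proper path* if (i) any two adjacent edges on the path differ in colour, (ii) any two adjacent internal vertices on the path differ in colour, and (iii) any internal vertex of the path differs in colour from its incident edges on the path. For a connected graph $F$, the *total proper connection number* $tpc(F)$ is the smallest number of colours in a total-colouring of $F$ for which any two vertices of $F$ are connected by a total proper path. The *strong product* $G\boxtimes H$ has vertex set $V(G)\times V(H)$, and $(g,h)$, $(g',h')$ are adjacent if and only if $gg'\in E(G)$ and $h=h'$, or $g=g'$ and $hh'\in E(H)$, or $gg'\in E(G)$ and $hh'\in E(H)$. **Theorem.** Let $G$ and $H$ be connected graphs, each with at least two vertices. If $G\boxtimes H$ is not a complete graph, then $tpc(G\boxtimes H)=3$. -/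

import Mathlib

namespace TotalProper

open SimpleGraph

/-- The strong product `G ⊠ H`: `(g, h)` and `(g', h')` are adjacent when `g g'` is an edge and
`h = h'`, or `g = g'` and `h h'` is an edge, or both `g g'` and `h h'` are edges. -/
def strongProd {V W : Type*} (G : SimpleGraph V) (H : SimpleGraph W) : SimpleGraph (V × W) where
  Adj x y := (G.Adj x.1 y.1 ∧ x.2 = y.2) ∨ (x.1 = y.1 ∧ H.Adj x.2 y.2) ∨
    (G.Adj x.1 y.1 ∧ H.Adj x.2 y.2)
  symm := ⟨fun x y h => by simpa only [eq_comm, G.adj_comm, H.adj_comm] using h⟩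
  loopless := ⟨fun x h => by simp at h⟩

/-- A total colouring of `G` with colours in `C`: every vertex and every edge gets a colour (with
no condition on the colours; both use the same set of colours). -/
structure TotalColoring {V : Type*} (G : SimpleGraph V) (C : Type*) where
  /-- the colours of the vertices -/
  vert : V → C
  /-- the colours of the edges -/
  edge : G.EdgeLabeling C

/-- The colour of the `i`-th edge (`i < p.length`) of the walk `p`, which joins `p.getVert i` to
`p.getVert (i + 1)`. -/
def TotalColoring.edgeAt {V C : Type*} {G : SimpleGraph V} (c : TotalColoring G C) {u v : V}
    (p : G.Walk u v) (i : ℕ) (hi : i < p.length) : C :=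
  c.edge.get (p.getVert i) (p.getVert (i + 1)) (p.adj_getVert_succ hi)

/-- A walk is a total proper path for the total colouring `c`. The vertices of `p` are
`p.getVert i` for `i ≤ p.length`, and the internal ones are those with `0 < i < p.length`. -/
structure IsTotalProperPath {V C : Type*} {G : SimpleGraph V} (c : TotalColoring G C) {u v : V}
    (p : G.Walk u v) : Prop where
  /-- no vertex is repeated -/
  isPath : p.IsPath
  /-- adjacent edges of the path differ in colour -/
  edge_ne_edge : ∀ (i : ℕ) (hi : i + 1 < p.length),
    c.edgeAt p i (Nat.lt_of_succ_lt hi) ≠ c.edgeAt p (i + 1) hi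
  /-- adjacent internal vertices of the path differ in colour -/
  vert_ne_vert : ∀ i : ℕ, 0 < i → i + 1 < p.length →
    c.vert (p.getVert i) ≠ c.vert (p.getVert (i + 1))
  /-- an internal vertex differs in colour from both edges of the path incident with it -/
  vert_ne_edge : ∀ (i : ℕ) (hi : i + 1 < p.length),
    c.vert (p.getVert (i + 1)) ≠ c.edgeAt p i (Nat.lt_of_succ_lt hi) ∧
      c.vert (p.getVert (i + 1)) ≠ c.edgeAt p (i + 1) hi

/-- The total-coloured graph is total-proper connected: any two vertices are joined by a total
proper path. -/
def IsTotalProperConnected {V C : Type*} {G : SimpleGraph V} (c : TotalColoring G C) : Prop :=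
  ∀ u v : V, ∃ p : G.Walk u v, IsTotalProperPath c p

/-- The total proper connection number: the smallest number of colours with which `G` can be made
total-proper connected. -/
noncomputable def tpc {V : Type*} (G : SimpleGraph V) : ℕ :=
  sInf {k : ℕ | ∃ c : TotalColoring G (Fin k), IsTotalProperConnected c}

end TotalProper

/-!
Three colours are needed because two non-adjacent vertices can only be joined through an internal
vertex, which together with its two edges on the path takes three distinct colours.

For the upper bound colour with `ZMod 3`. A path is total proper as soon as the colours along it
rotate: for some `δ ≠ 0`, each edge leaving an internal vertex `v` has colour `f v - δ`, and each
edge entering it has colour `f v + δ` (`isTotalProperPath_of_rotating`). Suppose that the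
vertices of the graph are split into two rooted trees whose roots are adjacent, and that each
vertex other than the roots has a neighbour in the other tree (`TwinTrees`). Colour one tree by
minus the depth and the other by one plus the depth, and give each tree edge, as well as the edge
between the roots, the third colour, different from the colours of its ends. Climbing one tree to
its root, crossing to the other root and descending there is then a rotating path, which joins any
two vertices in different trees. For `x` and `y` in the same tree, either `x` is an ancestor of `y`,
or one first steps from `x` to its chosen neighbour in the other tree and goes on to `y` as before.
The edge of that first step lies in neither tree, so its colour is free to fit the rotation.

The strong product `G ⊠ H` carries such a pair of trees. Root `G` at a vertex `r`, choose an edge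
`s₀ s₁` of `H`, and let each vertex of `H` belong to the nearer one of `s₀` and `s₁`. The tree
of `(g, w)` is given by the parity of `dist r g` plus the side of `w`. Inside a tree one first
moves `w` to its end of the edge `s₀ s₁`, and then lets `g` approach `r`, swapping `s₀` and `s₁` at
each (diagonal) step: the two trees pass each other on the diagonals of the copies of `K₄`.
-/

namespace TotalProper

open SimpleGraph

/-! ### Rotating paths -/

section Rotating

variable {X : Type*} {Q : SimpleGraph X}

/-- The total colouring with vertex colours `f` and edge colours `e`, where `e` is defined on all
unordered pairs. -/
def TotalColoring.ofSym2 {C : Type*} (Q : SimpleGraph X) (f : X → C) (e : Sym2 X → C) :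
    TotalColoring Q C where
  vert := f
  edge := fun z => e z

/-- All steps of the walk `p` rotate in direction `δ`: an edge from `v` to `w` on `p` has the colour
`f v - δ = f w + δ`. -/
def Rotates (f : X → ZMod 3) (e : Sym2 X → ZMod 3) (δ : ZMod 3) {u v : X} (p : Q.Walk u v) :
    Prop :=
  ∀ d ∈ p.darts, e s(d.fst, d.snd) = f d.fst - δ ∧ e s(d.fst, d.snd) = f d.snd + δ

variable {f : X → ZMod 3} {e : Sym2 X → ZMod 3} {δ : ZMod 3} {u v w : X}

lemma Rotates.getVert {p : Q.Walk u v} (h : Rotates f e δ p) (i : ℕ) (hi : i < p.length) :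
    e s(p.getVert i, p.getVert (i + 1)) = f (p.getVert i) - δ ∧
      e s(p.getVert i, p.getVert (i + 1)) = f (p.getVert (i + 1)) + δ := by
  have hi' : i < p.darts.length := by rwa [Walk.length_darts]
  have := h _ (List.getElem_mem hi')
  rwa [Walk.darts_getElem_eq_getVert] at this

lemma Rotates.reverse {p : Q.Walk u v} (h : Rotates f e δ p) : Rotates f e (-δ) p.reverse := by
  intro d hd
  obtain ⟨h1, h2⟩ := h _ (Walk.mem_darts_reverse.1 hd)
  simp only [Dart.symm, Prod.fst_swap, Prod.snd_swap] at h1 h2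
  rw [Sym2.eq_swap, sub_neg_eq_add, ← sub_eq_add_neg]
  exact ⟨h2, h1⟩

lemma Rotates.append {p : Q.Walk u v} {q : Q.Walk v w} (hp : Rotates f e δ p)
    (hq : Rotates f e δ q) : Rotates f e δ (p.append q) := by
  intro d hd
  rw [Walk.darts_append, List.mem_append] at hd
  exact hd.elim (hp d) (hq d)

lemma Rotates.cons {p : Q.Walk v w} (h : Q.Adj u v) (hp : Rotates f e δ p)
    (h1 : e s(u, v) = f u - δ) (h2 : e s(u, v) = f v + δ) : Rotates f e δ (Walk.cons h p) := by
  intro d hd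
  rw [Walk.darts_cons, List.mem_cons] at hd
  rcases hd with rfl | hd
  · exact ⟨h1, h2⟩
  · exact hp d hd

/-- A path is total proper if the colours rotate at its internal vertices; the colours of its two
ends are irrelevant. -/
lemma isTotalProperPath_of_rotating (hδ : δ ≠ 0) (p : Q.Walk u v) (hp : p.IsPath)
    (hout : ∀ i, 0 < i → i < p.length →
      e s(p.getVert i, p.getVert (i + 1)) = f (p.getVert i) - δ)
    (hin : ∀ i, i + 1 < p.length →
      e s(p.getVert i, p.getVert (i + 1)) = f (p.getVert (i + 1)) + δ) :
    IsTotalProperPath (TotalColoring.ofSym2 Q f e) p := by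
  have key : ∀ a d : ZMod 3, d ≠ 0 →
      a + d ≠ a - d ∧ a ≠ a + d ∧ a ≠ a - d := by decide
  refine ⟨hp, fun i hi => ?_, fun i h0 hi => ?_, fun i hi => ?_⟩
  · change e s(p.getVert i, p.getVert (i + 1)) ≠ e s(p.getVert (i + 1), p.getVert (i + 1 + 1))
    rw [hin i hi, hout (i + 1) (by lia) hi]
    exact (key _ _ hδ).1
  · change f (p.getVert i) ≠ f (p.getVert (i + 1))
    intro heq
    have h1 := hout i h0 (by lia)
    rw [hin i hi, ← heq] at h1
    exact (key _ _ hδ).1 h1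
  · change f (p.getVert (i + 1)) ≠ e s(p.getVert i, p.getVert (i + 1)) ∧
      f (p.getVert (i + 1)) ≠ e s(p.getVert (i + 1), p.getVert (i + 1 + 1))
    rw [hin i hi, hout (i + 1) (by lia) hi]
    exact (key _ _ hδ).2

lemma Rotates.isTotalProperPath (hδ : δ ≠ 0) {p : Q.Walk u v} (hp : p.IsPath)
    (h : Rotates f e δ p) : IsTotalProperPath (TotalColoring.ofSym2 Q f e) p :=
  isTotalProperPath_of_rotating hδ p hp (fun i _ hi => (h.getVert i hi).1)
    (fun i hi => (h.getVert i (by lia)).2)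

/-- The first vertex of a total proper path may have any colour. -/
lemma Rotates.isTotalProperPath_cons (hδ : δ ≠ 0) {p : Q.Walk v w} (hp : p.IsPath)
    (h : Rotates f e δ p) (ha : Q.Adj u v) (hu : u ∉ p.support) (he : e s(u, v) = f v + δ) :
    IsTotalProperPath (TotalColoring.ofSym2 Q f e) (Walk.cons ha p) := by
  refine isTotalProperPath_of_rotating hδ _ (hp.cons hu) (fun i h0 hi => ?_) fun i hi => ?_
  · obtain ⟨j, rfl⟩ := Nat.exists_eq_add_of_lt h0
    simp only [zero_add, Walk.length_cons, Walk.getVert_cons_succ] at hi ⊢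
    exact (h.getVert j (by lia)).1
  · cases i with
    | zero => simpa using he
    | succ j =>
      simp only [Walk.length_cons, Walk.getVert_cons_succ] at hi ⊢
      exact (h.getVert j (by lia)).2

end Rotating

/-! ### Two disjoint spanning trees that dominate each other -/

/-- A partition of the vertices of `Q` into two rooted trees, indexed by `Bool`, with adjacent
roots, such that each vertex other than the roots has a neighbour in the other tree. The trees are
given by parent functions; the values of `parent` and `cross` at the roots are irrelevant. -/
structure TwinTrees {X : Type*} (Q : SimpleGraph X) where
  /-- the tree of a vertex -/
  side : X → Bool
  /-- the depth of a vertex in its tree -/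
  depth : X → ℕ
  /-- the two roots -/
  root : Bool → X
  /-- the parent of a vertex in its tree -/
  parent : X → X
  /-- the chosen neighbour in the other tree -/
  cross : X → X
  side_root : ∀ b, side (root b) = b
  depth_root : ∀ b, depth (root b) = 0
  eq_root : ∀ x, depth x = 0 → x = root (side x)
  adj_root : ∀ b, Q.Adj (root b) (root !b)
  adj_parent : ∀ x, depth x ≠ 0 → Q.Adj x (parent x)
  side_parent : ∀ x, depth x ≠ 0 → side (parent x) = side x
  depth_parent : ∀ x, depth x ≠ 0 → depth (parent x) + 1 = depth x
  adj_cross : ∀ x, depth x ≠ 0 → Q.Adj x (cross x)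
  side_cross : ∀ x, depth x ≠ 0 → side (cross x) = !side x
  /-- no edge is chosen by both of its ends, so that each chosen edge can be coloured to suit the
  end that chose it -/
  cross_cross : ∀ x, depth x ≠ 0 → depth (cross x) ≠ 0 → cross (cross x) ≠ x

namespace TwinTrees

variable {X : Type*} {Q : SimpleGraph X} (T : TwinTrees Q)

/-- The direction in which colours rotate on the way up the tree `b`. -/
def dir (b : Bool) : ZMod 3 := bif b then -1 else 1

lemma dir_ne_zero (b : Bool) : dir b ≠ 0 := by cases b <;> decide

lemma dir_not (b : Bool) : dir (!b) = -dir b := by cases b <;> decide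

/-- The vertex colours: minus the depth in one tree, and one plus the depth in the other. -/
def vertColor (x : X) : ZMod 3 := bif T.side x then T.depth x + 1 else -T.depth x

open Classical in
/-- The edge colours: an edge from a vertex `x` to its chosen neighbour in the other tree prepares
for a rotation that goes up that tree; all other edges get the third colour, different from the
colours of their ends. -/
noncomputable def edgeColor (z : Sym2 X) : ZMod 3 :=
  if h : ∃ x, T.depth x ≠ 0 ∧ z = s(x, T.cross x) then
    T.vertColor (T.cross h.choose) + dir (T.side (T.cross h.choose))
  else Sym2.lift ⟨fun x y => -(T.vertColor x + T.vertColor y), fun x y => by ring⟩ z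

lemma vertColor_parent {x : X} (hx : T.depth x ≠ 0) :
    T.vertColor (T.parent x) = T.vertColor x + dir (T.side x) := by
  have h : (T.depth x : ZMod 3) = T.depth (T.parent x) + 1 := by
    rw [← T.depth_parent x hx]; push_cast; rfl
  rw [vertColor, vertColor, T.side_parent x hx, h]
  cases T.side x <;> simp [dir]

lemma vertColor_root (b : Bool) : T.vertColor (T.root !b) = T.vertColor (T.root b) + dir b := by
  cases b <;> simp [vertColor, dir, T.side_root, T.depth_root]

lemma edgeColor_cross {x : X} (hx : T.depth x ≠ 0) :
    T.edgeColor s(x, T.cross x) = T.vertColor (T.cross x) + dir (T.side (T.cross x)) := by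
  have h : ∃ y, T.depth y ≠ 0 ∧ s(x, T.cross x) = s(y, T.cross y) := ⟨x, hx, rfl⟩
  have hy : h.choose = x := by
    obtain ⟨hd, he⟩ := h.choose_spec
    rcases Sym2.eq_iff.1 he with ⟨h1, -⟩ | ⟨h1, h2⟩
    · exact h1.symm
    · exact absurd (by rw [h2, ← h1]) (T.cross_cross x hx (by rwa [h2]))
  rw [edgeColor, dif_pos h, hy]

lemma edgeColor_parent {x : X} (hx : T.depth x ≠ 0) :
    T.edgeColor s(x, T.parent x) = -(T.vertColor x + T.vertColor (T.parent x)) := by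
  rw [edgeColor, dif_neg]
  · rfl
  · rintro ⟨y, hy, he⟩
    have hs := T.side_cross y hy
    have hp := T.side_parent x hx
    rcases Sym2.eq_iff.1 he with ⟨h1, h2⟩ | ⟨h1, h2⟩
    · rw [← h2, ← h1, hp] at hs
      simp at hs
    · rw [← h1, ← h2, hp] at hs
      simp at hs

lemma edgeColor_root (b : Bool) :
    T.edgeColor s(T.root b, T.root !b) =
      -(T.vertColor (T.root b) + T.vertColor (T.root !b)) := by
  rw [edgeColor, dif_neg]
  · rfl
  · rintro ⟨y, hy, he⟩
    rcases Sym2.eq_iff.1 he with ⟨h1, -⟩ | ⟨-, h1⟩ <;>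
      exact hy (by rw [← h1, T.depth_root])

/-- An edge with the third colour fits a rotation along it. -/
lemma third_color {a b d : ZMod 3} (h : b = a + d) : -(a + b) = a - d ∧ -(a + b) = b + d := by
  subst h
  revert a d
  decide

/-- The path up the tree from `x` to its root: it stays in the tree, and its colours rotate. -/
lemma exists_ascent {x : X} {b : Bool} (hb : T.side x = b) :
    ∃ p : Q.Walk x (T.root b), p.IsPath ∧
      (∀ y ∈ p.support, T.side y = b ∧ T.depth y ≤ T.depth x) ∧
        Rotates T.vertColor T.edgeColor (dir b) p := by
  induction hn : T.depth x generalizing x with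
  | zero =>
    obtain rfl : x = T.root b := hb ▸ T.eq_root x hn
    exact ⟨Walk.nil, Walk.IsPath.nil, by simp [hn, hb], by simp [Rotates]⟩
  | succ n ih =>
    have hx : T.depth x ≠ 0 := by lia
    have hd := T.depth_parent x hx
    obtain ⟨p, hp, hs, hr⟩ := ih ((T.side_parent x hx).trans hb) (by lia)
    obtain ⟨h1, h2⟩ := third_color (T.vertColor_parent hx)
    rw [← T.edgeColor_parent hx, hb] at h1 h2
    refine ⟨Walk.cons (T.adj_parent x hx) p, hp.cons fun hmem => ?_, fun y hy => ?_,
      hr.cons _ h1 h2⟩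
    · have := (hs x hmem).2
      lia
    · rw [Walk.support_cons, List.mem_cons] at hy
      rcases hy with rfl | hy
      · exact ⟨hb, hn.le⟩
      · exact ⟨(hs y hy).1, (hs y hy).2.trans (by lia)⟩

/-- Two vertices in different trees are joined by a path over both roots, whose colours rotate; it
meets the tree of `y` only in ancestors of `y`, the vertices of the path `q`. -/
lemma exists_path_of_side_ne {x y : X} {b : Bool} (q : Q.Walk y (T.root !b)) (hq : q.IsPath)
    (hqs : ∀ z ∈ q.support, T.side z = !b)
    (hqr : Rotates T.vertColor T.edgeColor (dir !b) q) (hx : T.side x = b) :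
    ∃ p : Q.Walk x y, p.IsPath ∧ (∀ z ∈ p.support, T.side z = (!b) → z ∈ q.support) ∧
      Rotates T.vertColor T.edgeColor (dir b) p := by
  obtain ⟨p, hp, hs, hr⟩ := T.exists_ascent hx
  have hr2 : Rotates T.vertColor T.edgeColor (dir b) (Walk.cons (T.adj_root b) q.reverse) := by
    have h0 := hqr.reverse
    rw [dir_not, neg_neg] at h0
    obtain ⟨h1, h2⟩ := third_color (T.vertColor_root b)
    rw [← T.edgeColor_root] at h1 h2
    exact h0.cons _ h1 h2
  have hsup : (p.append (Walk.cons (T.adj_root b) q.reverse)).support =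
      p.support ++ q.support.reverse := by
    simp [Walk.support_append]
  refine ⟨p.append (Walk.cons (T.adj_root b) q.reverse), ?_, ?_, hr.append hr2⟩
  · rw [Walk.isPath_def, hsup, List.nodup_append']
    refine ⟨hp.support_nodup, List.nodup_reverse.2 hq.support_nodup, fun z h1 h2 => ?_⟩
    have := (hqs z (List.mem_reverse.1 h2)).symm.trans (hs z h1).1
    simp at this
  · intro z hz hzs
    rw [hsup, List.mem_append, List.mem_reverse] at hz
    refine hz.resolve_left fun h => ?_
    have := hzs.symm.trans (hs z h).1
    simp at this

theorem isTotalProperConnected :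
    IsTotalProperConnected (TotalColoring.ofSym2 Q T.vertColor T.edgeColor) := by
  classical
  intro x y
  obtain ⟨b, hb⟩ : ∃ b, T.side y = !b := ⟨!T.side y, by simp⟩
  obtain ⟨q, hq, hqs, hqr⟩ := T.exists_ascent hb
  by_cases hxy : T.side x = b
  · obtain ⟨p, hp, -, hr⟩ :=
      T.exists_path_of_side_ne q hq (fun z hz => (hqs z hz).1) hqr hxy
    exact ⟨p, hr.isTotalProperPath (dir_ne_zero _) hp⟩
  have hxb : T.side x = !b := Bool.eq_not_of_ne hxy
  by_cases hx : x ∈ q.support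
  · have hx' : x ∈ q.reverse.support := by simpa using hx
    exact ⟨q.reverse.dropUntil x hx', Rotates.isTotalProperPath
      (neg_ne_zero.2 (dir_ne_zero (!b))) (hq.reverse.dropUntil hx')
      fun d hd => hqr.reverse d (q.reverse.darts_dropUntil_subset_darts hx' hd)⟩
  · have hd : T.depth x ≠ 0 := by
      intro h
      rw [T.eq_root x h, hxb] at hx
      exact hx q.end_mem_support
    have hc : T.side (T.cross x) = b := by rw [T.side_cross x hd, hxb, Bool.not_not]
    obtain ⟨p, hp, hs, hr⟩ :=
      T.exists_path_of_side_ne q hq (fun z hz => (hqs z hz).1) hqr hc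
    exact ⟨Walk.cons (T.adj_cross x hd) p, hr.isTotalProperPath_cons (dir_ne_zero _) hp _
      (fun h => hx (hs x h hxb)) (hc ▸ T.edgeColor_cross hd)⟩

end TwinTrees

/-! ### The two trees in a strong product -/

section StrongProduct

variable {V W : Type*} {G : SimpleGraph V} {H : SimpleGraph W}

lemma exists_adj_dist_add_one (hG : G.Connected) (r : V) {v : V} (hv : v ≠ r) :
    ∃ v', G.Adj v v' ∧ G.dist r v' + 1 = G.dist r v := by
  obtain ⟨p, hp⟩ := hG.exists_walk_length_eq_dist v r
  cases p with
  | nil => exact absurd rfl hv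
  | cons h q =>
    rename_i v'
    refine ⟨v', h, ?_⟩
    have h1 := dist_le q
    have h2 := hG.dist_triangle (u := v) (v := v') (w := r)
    rw [dist_eq_one_iff_adj.2 h] at h2
    rw [Walk.length_cons] at hp
    rw [dist_comm (u := r), dist_comm (u := r)]
    lia

/-- Each vertex of a connected graph belongs to the nearer end of a given edge: two rooted trees
span the graph, with the ends of the edge as their roots. -/
lemma exists_split (hH : H.Connected) {s₀ s₁ : W} (hs : H.Adj s₀ s₁) :
    ∃ (side : W → Bool) (depth : W → ℕ) (parent : W → W),
      side s₀ = false ∧ side s₁ = true ∧ (∀ w, depth w = 0 ↔ w = bif side w then s₁ else s₀) ∧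
      ∀ w, depth w ≠ 0 → H.Adj w (parent w) ∧ side (parent w) = side w ∧
        depth (parent w) + 1 = depth w := by
  have h01 : H.dist s₀ s₁ = 1 := dist_eq_one_iff_adj.2 hs
  have h10 : H.dist s₁ s₀ = 1 := dist_eq_one_iff_adj.2 hs.symm
  have key : ∀ w, ∃ w', min (H.dist s₀ w) (H.dist s₁ w) ≠ 0 → H.Adj w w' ∧
      (decide (H.dist s₁ w' < H.dist s₀ w') = decide (H.dist s₁ w < H.dist s₀ w)) ∧
        min (H.dist s₀ w') (H.dist s₁ w') + 1 = min (H.dist s₀ w) (H.dist s₁ w) := by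
    intro w
    by_cases hw : min (H.dist s₀ w) (H.dist s₁ w) = 0
    · exact ⟨w, fun h => absurd hw h⟩
    have h0 : w ≠ s₀ := by rintro rfl; simp at hw
    have h1 : w ≠ s₁ := by rintro rfl; simp at hw
    by_cases hlt : H.dist s₁ w < H.dist s₀ w
    · obtain ⟨w', ha, hd⟩ := exists_adj_dist_add_one hH s₁ h1
      have ht := hH.dist_triangle (u := s₀) (v := w') (w := w)
      rw [dist_eq_one_iff_adj.2 ha.symm] at ht
      exact ⟨w', fun _ => ⟨ha, decide_eq_decide.2 (by lia), by lia⟩⟩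
    · obtain ⟨w', ha, hd⟩ := exists_adj_dist_add_one hH s₀ h0
      have ht := hH.dist_triangle (u := s₁) (v := w') (w := w)
      rw [dist_eq_one_iff_adj.2 ha.symm] at ht
      exact ⟨w', fun _ => ⟨ha, decide_eq_decide.2 (by lia), by lia⟩⟩
  choose parent hparent using key
  refine ⟨fun w => decide (H.dist s₁ w < H.dist s₀ w), fun w => min (H.dist s₀ w) (H.dist s₁ w),
    parent, by simp, by simp [h01], fun w => ?_, hparent⟩
  by_cases hlt : H.dist s₁ w < H.dist s₀ w
  · have : H.dist s₁ w = 0 ↔ s₁ = w := hH.dist_eq_zero_iff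
    simp only [hlt, decide_true, cond_true, eq_comm (a := w), ← this]
    lia
  · have : H.dist s₀ w = 0 ↔ s₀ = w := hH.dist_eq_zero_iff
    simp only [hlt, decide_false, cond_false, eq_comm (a := w), ← this]
    lia

/-- The parity of `n`, as an index of a tree. -/
def parity (n : ℕ) : Bool := decide (n % 2 = 1)

lemma parity_succ (n : ℕ) : parity (n + 1) = !parity n := by
  unfold parity
  rw [← decide_not, decide_eq_decide]
  lia

lemma nonempty_twinTrees [Nontrivial V] [Nontrivial W] (hG : G.Connected) (hH : H.Connected) :
    Nonempty (TwinTrees (strongProd G H)) := by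
  classical
  obtain ⟨r⟩ := hG.nonempty
  obtain ⟨s₀⟩ := hH.nonempty
  obtain ⟨g₁, hg₁⟩ := hG.preconnected.exists_adj_of_nontrivial r
  obtain ⟨s₁, hs⟩ := hH.preconnected.exists_adj_of_nontrivial s₀
  obtain ⟨σ, δ, π, hs0, hs1, hδ, hπ⟩ := exists_split hH hs
  have hγ : ∀ g, ∃ g', g ≠ r → G.Adj g g' ∧ G.dist r g' + 1 = G.dist r g := by
    intro g
    by_cases hg : g = r
    · exact ⟨g, fun h => absurd hg h⟩
    · obtain ⟨g', h⟩ := exists_adj_dist_add_one hG r hg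
      exact ⟨g', fun _ => h⟩
  choose γ hγ using hγ
  have hr : ∀ g, G.dist r g = 0 ↔ g = r := fun g => by rw [hG.dist_eq_zero_iff, eq_comm]
  have hg₁d : G.dist r g₁ = 1 := dist_eq_one_iff_adj.2 hg₁
  have hpar : ∀ g, g ≠ r → parity (G.dist r g) = !parity (G.dist r (γ g)) := fun g hg => by
    rw [← (hγ g hg).2, parity_succ]
  -- the end of the edge `s₀ s₁` with a given side
  let s : Bool → W := fun b => bif b then s₁ else s₀
  have hσs : ∀ b, σ (s b) = b := by rintro (_ | _) <;> assumption
  have hδs : ∀ b, δ (s b) = 0 := fun b => (hδ _).2 (by rw [hσs])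
  have hws : ∀ w, δ w = 0 → w = s (σ w) := fun w h => (hδ w).1 h
  have hsadj : ∀ b, H.Adj (s b) (s !b) := by
    rintro (_ | _)
    exacts [hs, hs.symm]
  refine ⟨{
    side := fun x => xor (parity (G.dist r x.1)) (σ x.2)
    depth := fun x => G.dist r x.1 + δ x.2
    root := fun b => (r, s b)
    parent := fun x => if δ x.2 = 0 then (γ x.1, s !σ x.2) else (x.1, π x.2)
    cross := fun x => if x.1 = r then (g₁, π x.2) else (γ x.1, x.2)
    side_root := ?_
    depth_root := ?_
    eq_root := ?_
    adj_root := ?_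
    adj_parent := ?_
    side_parent := ?_
    depth_parent := ?_
    adj_cross := ?_
    side_cross := ?_
    cross_cross := ?_ }⟩
  · intro b
    simp [parity, hσs]
  · intro b
    simp [hδs]
  · rintro ⟨g, w⟩ h
    obtain ⟨h1, h2⟩ := Nat.add_eq_zero_iff.1 h
    obtain rfl := (hr g).1 h1
    simpa [parity] using hws w h2
  · intro b
    exact .inr (.inl ⟨rfl, hsadj b⟩)
  · rintro ⟨g, w⟩ h
    dsimp only at h ⊢
    split_ifs with hw
    · have hg : g ≠ r := fun hg => h (by rw [hw, (hr g).2 hg])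
      refine .inr (.inr ⟨(hγ g hg).1, ?_⟩)
      have := hsadj (σ w)
      rwa [← hws w hw] at this
    · exact .inr (.inl ⟨rfl, (hπ w hw).1⟩)
  · rintro ⟨g, w⟩ h
    dsimp only at h ⊢
    split_ifs with hw
    · have hg : g ≠ r := fun hg => h (by rw [hw, (hr g).2 hg])
      simp [hσs, hpar g hg]
    · simp [(hπ w hw).2.1]
  · rintro ⟨g, w⟩ h
    dsimp only at h ⊢
    split_ifs with hw
    · have hg : g ≠ r := fun hg => h (by rw [hw, (hr g).2 hg])
      rw [hδs, hw]
      exact (hγ g hg).2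
    · rw [← (hπ w hw).2.2]
      rfl
  · rintro ⟨g, w⟩ h
    dsimp only at h ⊢
    split_ifs with hg
    · subst hg
      have hw : δ w ≠ 0 := fun hw => h (by rw [hw, dist_self])
      exact .inr (.inr ⟨hg₁, (hπ w hw).1⟩)
    · exact .inl ⟨(hγ g hg).1, rfl⟩
  · rintro ⟨g, w⟩ h
    dsimp only at h ⊢
    split_ifs with hg
    · subst hg
      have hw : δ w ≠ 0 := fun hw => h (by rw [hw, dist_self])
      simp [hg₁d, (hπ w hw).2.1, parity]
    · simp [hpar g hg]
  · rintro ⟨g, w⟩ h hc heq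
    dsimp only at h hc heq
    split_ifs at heq with hg h1 h1
    · exact hg₁.ne h1.symm
    · subst hg
      have hw : δ w ≠ 0 := fun hw => h (by rw [hw, dist_self])
      exact (hπ w hw).1.ne (Prod.ext_iff.1 heq).2.symm
    -- here `γ g = r`, and the neighbour chosen by `(r, w)` lies over `π w`, not over `w`
    · have hw : δ w ≠ 0 := fun hw => hc (by rw [if_neg hg, (hr _).2 h1, hw])
      exact (hπ w hw).1.ne (Prod.ext_iff.1 heq).2.symm
    · have h2 := (hγ g hg).2
      have h3 : G.dist r (γ (γ g)) + 1 = G.dist r (γ g) := (hγ _ h1).2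
      rw [show γ (γ g) = g from (Prod.ext_iff.1 heq).1] at h3
      lia

end StrongProduct

/-! ### The lower bound -/

lemma three_le_of_isTotalProperConnected {X : Type*} {Q : SimpleGraph X} (hQ : Q ≠ ⊤) {k : ℕ}
    {c : TotalColoring Q (Fin k)} (hc : IsTotalProperConnected c) : 3 ≤ k := by
  obtain ⟨u, v, huv, hadj⟩ : ∃ u v, u ≠ v ∧ ¬Q.Adj u v := by
    by_contra! h
    exact hQ (eq_top_iff.2 fun u v huv => h u v huv)
  obtain ⟨p, hp⟩ := hc u v
  have hlen : 0 + 1 < p.length := by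
    rcases Nat.lt_or_ge 1 p.length with h | h
    · exact h
    · interval_cases hl : p.length
      · exact absurd (Walk.eq_of_length_eq_zero hl) huv
      · exact absurd (Walk.adj_of_length_eq_one hl) hadj
  have h1 := hp.edge_ne_edge 0 hlen
  obtain ⟨h2, h3⟩ := hp.vert_ne_edge 0 hlen
  have hcard : ({c.vert (p.getVert (0 + 1)), c.edgeAt p 0 (Nat.lt_of_succ_lt hlen),
      c.edgeAt p (0 + 1) hlen} : Finset (Fin k)).card = 3 :=
    Finset.card_eq_three.2 ⟨_, _, _, h2, h3, h1, rfl⟩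
  simpa [hcard] using Finset.card_le_univ ({c.vert (p.getVert (0 + 1)),
    c.edgeAt p 0 (Nat.lt_of_succ_lt hlen), c.edgeAt p (0 + 1) hlen} : Finset (Fin k))

end TotalProper

theorem theorem5 {V W : Type*} [Finite V] [Finite W] [Nontrivial V] [Nontrivial W]
    (G : SimpleGraph V) (H : SimpleGraph W) (hG : G.Connected) (hH : H.Connected)
    (hGH : TotalProper.strongProd G H ≠ ⊤) :
    TotalProper.tpc (TotalProper.strongProd G H) = 3 := by
  obtain ⟨T⟩ := TotalProper.nonempty_twinTrees hG hH
  have hmem : 3 ∈ {k : ℕ | ∃ c : TotalProper.TotalColoring (TotalProper.strongProd G H) (Fin k),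
      TotalProper.IsTotalProperConnected c} := ⟨_, T.isTotalProperConnected⟩
  refine le_antisymm (Nat.sInf_le hmem) (le_csInf ⟨3, hmem⟩ ?_)
  rintro k ⟨c, hc⟩
  exact TotalProper.three_le_of_isTotalProperConnected hGH hc
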